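/- Let $\mathcal{L}$ be a finite-dimensional complex vector space on which a group $G$ acts linearly, and assume that $\mathcal{L}$ is an irreducible $G$-module. Let $V\subseteq\mathcal{L}$ be an irreducible affine cone, i.e. a Zariski-closed subset which is irreducible as a variety and satisfies $\mathbb{C}\cdot V\subseteq V$. Assume that $V$ is $G$-invariant and has dimension $N\ge 1$ (that is, $V\neq\{0\}$). For $m\in\mathbb{N}$ let $\sigma_mV$ be the $m$-th secant variety, the Zariski closure of $\{x_1+\dots+x_m \mid x_1,\dots,x_m\in V\}$ in $\mathcal{L}$. Call $V$ $m$-defective if $\dim\sigma_mV<\min\{mN,\dim\mathcal{L}\}$, and $m$-nondefective otherwise. The generic rank $m^\circ$ with respect to $V$ is the smallest $m$ such that $\sigma_mV=\mathcal{L}$. Then: 1. $V$ is $m$-nondefective for all $m\in\mathbb{N}$ with $m\le\frac{\dim\mathcal{L}}{N}-N$. 2. The generic rank $m^\circ$ exists and satisfies $\frac{\dim\mathcal{L}}{N}\le m^\circ\le\frac{\dim\mathcal{L}}{N}+N$. -/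

import Mathlib

namespace SecantNondefectivity

/-- The algebra of polynomial functions on a complex vector space `L`: the subalgebra of all
functions `L → ℂ` that is generated by the linear functionals. -/
def polynomialFunctions (L : Type*) [AddCommGroup L] [Module ℂ L] : Subalgebra ℂ (L → ℂ) :=
  Algebra.adjoin ℂ (Set.range fun φ : Module.Dual ℂ L => (φ : L → ℂ))

/-- The common zero set of a set of functions on `L`. -/
def zeroSet {L : Type*} (S : Set (L → ℂ)) : Set L := {x | ∀ f ∈ S, f x = 0}

/-- The Zariski topology on `L`: the closed sets are the common zero sets of sets of polynomial
functions. -/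
@[reducible]
def zariskiTopology (L : Type*) [AddCommGroup L] [Module ℂ L] : TopologicalSpace L :=
  TopologicalSpace.ofClosed {V | ∃ S ⊆ (polynomialFunctions L : Set (L → ℂ)), V = zeroSet S}
    ⟨{1}, by simp, by ext x; simp [zeroSet]⟩
    (by
      intro A hA
      refine ⟨⋃₀ {S | S ⊆ (polynomialFunctions L : Set (L → ℂ)) ∧ zeroSet S ∈ A},
        Set.sUnion_subset fun S hS => hS.1, ?_⟩
      ext x
      constructor
      · rintro h f ⟨S, ⟨-, hS⟩, hf⟩
        exact h _ hS f hf
      · intro h V hV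
        obtain ⟨S, hS, rfl⟩ := hA hV
        exact fun f hf => h f ⟨S, ⟨hS, hV⟩, hf⟩)
    (by
      rintro _ ⟨S, hS, rfl⟩ _ ⟨T, hT, rfl⟩
      refine ⟨{h | ∃ f ∈ S, ∃ g ∈ T, h = f * g}, ?_, ?_⟩
      · rintro _ ⟨f, hf, g, hg, rfl⟩
        exact (polynomialFunctions L).mul_mem (hS hf) (hT hg)
      · ext x
        simp only [zeroSet, Set.mem_union, Set.mem_ofPred_eq]
        constructor
        · rintro (h | h) _ ⟨f, hf, g, hg, rfl⟩
          · simp [h f hf]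
          · simp [h g hg]
        · intro h
          by_contra! hc
          obtain ⟨⟨f, hf, hfx⟩, g, hg, hgx⟩ := hc
          have := h _ ⟨f, hf, g, hg, rfl⟩
          simp [hfx, hgx] at this)

/-- The coordinate ring of `V ⊆ L`: the algebra of restrictions to `V` of polynomial functions
on `L`, i.e. the algebra generated by the restrictions to `V` of the linear functionals. -/
def coordinateRing {L : Type*} [AddCommGroup L] [Module ℂ L] (V : Set L) : Subalgebra ℂ (V → ℂ) :=
  Algebra.adjoin ℂ (Set.range fun (φ : Module.Dual ℂ L) (v : V) => φ (v : L))

/-- The dimension of a variety `V` (as an affine variety in a finite-dimensional space `L`): the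
transcendence degree over `ℂ` of its coordinate ring. This is a finite cardinal, since the
coordinate ring is a finitely generated algebra; for irreducible `V` it is the transcendence degree
of the function field. -/
noncomputable def varietyDim {L : Type*} [AddCommGroup L] [Module ℂ L] (V : Set L) : ℕ :=
  Cardinal.toNat (Algebra.trdeg ℂ (coordinateRing V))

/-- An irreducible affine cone in `L`: a Zariski-closed subset that is irreducible in the Zariski
topology and closed under scaling by complex numbers. -/
structure IsIrreducibleAffineCone {L : Type*} [AddCommGroup L] [Module ℂ L] (V : Set L) :
    Prop where
  isClosed : @IsClosed L (zariskiTopology L) V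
  isIrreducible : @IsIrreducible L (zariskiTopology L) V
  smul_mem : ∀ (c : ℂ), ∀ v ∈ V, c • v ∈ V

/-- The `m`-th secant variety of `V`: the Zariski closure of the set of all sums `x₁ + ⋯ + xₘ` with
`x₁, …, xₘ ∈ V`. -/
def secantVariety {L : Type*} [AddCommGroup L] [Module ℂ L] (m : ℕ) (V : Set L) : Set L :=
  @closure L (zariskiTopology L) {y | ∃ x : Fin m → L, (∀ i, x i ∈ V) ∧ y = ∑ i, x i}

/-- The expected dimension of the `m`-th secant variety of `V`. -/
noncomputable def expectedDim {L : Type*} [AddCommGroup L] [Module ℂ L] (m : ℕ) (V : Set L) : ℕ :=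
  min (m * varietyDim V) (Module.finrank ℂ L)

/-- `V` is `m`-defective: the `m`-th secant variety has less than the expected dimension. -/
def IsDefective {L : Type*} [AddCommGroup L] [Module ℂ L] (m : ℕ) (V : Set L) : Prop :=
  varietyDim (secantVariety m V) < expectedDim m V

/-- `V` is `m`-nondefective. -/
def IsNondefective {L : Type*} [AddCommGroup L] [Module ℂ L] (m : ℕ) (V : Set L) : Prop :=
  ¬ IsDefective m V

/-- `r` is the generic rank with respect to `V`: the smallest `m` such that the `m`-th secant
variety of `V` is the whole space. -/
def IsGenericRank {L : Type*} [AddCommGroup L] [Module ℂ L] (V : Set L) (r : ℕ) : Prop :=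
  IsLeast {m : ℕ | secantVariety m V = Set.univ} r

end SecantNondefectivity

/-! Let `d m` be the dimension of the sum of the tangent spaces to `V` at `m` general points
(`tangentRank`), and `n = dim L`. Tangent vectors come from derivations of the coordinate ring, and
"general" means along `genericFilter`, a filter because powers of `V` are irreducible. One half of
Terracini's lemma suffices: `d m ≤ dim σ_m V` (`tangentRank_le_varietyDim`), and `σ_m V = L` as soon
as `d m = n` (`secantVariety_eq_univ`). Moreover `d 1 = N` (`tangentRank_one`).

The increment `d (m + 1) - d m` is `N` minus the dimension of the intersection of one general
tangent space `T` with the sum of `m` others. Suppose that this increment is below `N` and that the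
next one is not smaller. Then enlarging the `m` points by one does not enlarge the intersection, so
exchanging points one at a time shows that all `m`-subsets of a general configuration cut `T` in the
same nonzero subspace. With `T` and one `m`-subset fixed, a nonzero vector of this subspace lies in
the sum of the tangent spaces at `m` general points. The vectors with that property form a
`G`-submodule, which is `L` by irreducibility, so `d m = n` (`tangentRank_eq_finrank`).

Hence the increments equal `N` up to some index `k` and then decrease strictly until `d` reaches
`n`, so `d m = m * N` for `m ≤ k` and `d (k + N - 1) = n` (`Nat.exists_eq_mul_and_eq_bound`). From
`k * N ≤ n ≤ (k + N - 1) * N` both the nondefectivity range and the upper bound on the generic rank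
follow. The lower bound is a count of transcendence degrees (`finrank_le_of_secantVariety_eq_univ`).
-/

namespace SecantNondefectivity

/-! ### Zariski closure and general points of powers of `V` -/

open Filter Function

variable {L : Type*} [AddCommGroup L] [Module ℂ L] {V : Set L}

/-- Every element of the coordinate ring is the restriction of a polynomial function. -/
lemma exists_polynomialFunction_eq {f : V → ℂ} (hf : f ∈ coordinateRing V) :
    ∃ F ∈ polynomialFunctions L, ∀ v : V, F v = f v := by
  induction hf using Algebra.adjoin_induction with
  | mem f hf =>
    obtain ⟨φ, rfl⟩ := hf
    exact ⟨φ, Algebra.subset_adjoin ⟨φ, rfl⟩, fun _ => rfl⟩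
  | algebraMap r => exact ⟨algebraMap ℂ _ r, Subalgebra.algebraMap_mem _ r, fun _ => rfl⟩
  | add f g _ _ hf hg =>
    obtain ⟨F, hF, hFf⟩ := hf
    obtain ⟨G, hG, hGg⟩ := hg
    exact ⟨F + G, add_mem hF hG, fun v => by simp [hFf, hGg]⟩
  | mul f g _ _ hf hg =>
    obtain ⟨F, hF, hFf⟩ := hf
    obtain ⟨G, hG, hGg⟩ := hg
    exact ⟨F * G, mul_mem hF hG, fun v => by simp [hFf, hGg]⟩

lemma isOpen_zariski_ne_zero {F : L → ℂ} (hF : F ∈ polynomialFunctions L) :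
    @IsOpen L (zariskiTopology L) {x | F x ≠ 0} := by
  change {x | F x ≠ 0}ᶜ ∈ {V | ∃ S ⊆ (polynomialFunctions L : Set (L → ℂ)), V = zeroSet S}
  refine ⟨{F}, by simpa using hF, ?_⟩
  ext x
  simp [zeroSet]

/-- The closure in the Zariski topology is the common zero set of the polynomial functions that
vanish on the given set. -/
lemma mem_zariski_closure_iff {s : Set L} {y : L} :
    y ∈ @closure L (zariskiTopology L) s ↔
      ∀ F ∈ polynomialFunctions L, (∀ x ∈ s, F x = 0) → F y = 0 := by
  let _ := zariskiTopology L
  rw [mem_closure_iff]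
  constructor
  · intro h F hF hs
    by_contra hy
    obtain ⟨x, hx, hxs⟩ := h _ (isOpen_zariski_ne_zero hF) hy
    exact hx (hs x hxs)
  · intro h o ho hy
    obtain ⟨S, hS, hoS⟩ : oᶜ ∈
      {V | ∃ S ⊆ (polynomialFunctions L : Set (L → ℂ)), V = zeroSet S} := ho
    by_contra hne
    have hs : s ⊆ zeroSet S := by
      rw [← hoS]
      exact fun x hx hxo => hne ⟨x, hxo, hx⟩
    have : y ∈ oᶜ := by
      rw [hoS]
      exact fun F hF => h F (hS hF) fun x hx => hs hx F hF
    exact this hy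

lemma IsIrreducibleAffineCone.exists_ne_zero (hV : IsIrreducibleAffineCone V) {f g : V → ℂ}
    (hf : f ∈ coordinateRing V) (hg : g ∈ coordinateRing V) {a b : V} (ha : f a ≠ 0)
    (hb : g b ≠ 0) : ∃ v, f v ≠ 0 ∧ g v ≠ 0 := by
  obtain ⟨F, hF, hFf⟩ := exists_polynomialFunction_eq hf
  obtain ⟨G, hG, hGg⟩ := exists_polynomialFunction_eq hg
  obtain ⟨v, hv, hv1, hv2⟩ := hV.isIrreducible.2 _ _ (isOpen_zariski_ne_zero hF)
    (isOpen_zariski_ne_zero hG) ⟨a, a.2, by simpa [hFf] using ha⟩ ⟨b, b.2, by simpa [hGg] using hb⟩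
  refine ⟨⟨v, hv⟩, ?_, ?_⟩
  · rw [← hFf]; exact hv1
  · rw [← hGg]; exact hv2

/-- The restriction of a linear functional to `V`, as an element of the coordinate ring. -/
def linearCoord (V : Set L) : Module.Dual ℂ L →ₗ[ℂ] coordinateRing V where
  toFun φ := ⟨fun v => φ (v : L), Algebra.subset_adjoin ⟨φ, rfl⟩⟩
  map_add' _ _ := rfl
  map_smul' _ _ := rfl

@[simp] lemma linearCoord_apply (φ : Module.Dual ℂ L) (v : V) :
    (linearCoord V φ : V → ℂ) v = φ v := rfl

lemma adjoin_range_linearCoord : Algebra.adjoin ℂ (Set.range (linearCoord V)) = ⊤ := by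
  apply Subalgebra.map_injective (f := (coordinateRing V).val) Subtype.val_injective
  rw [AlgHom.map_adjoin, ← Set.range_comp, Algebra.map_top, Subalgebra.range_val]
  rfl

/-- The algebra of polynomial functions on the power `V ^ ι`. -/
def tupleRing (ι : Type*) (V : Set L) : Subalgebra ℂ ((ι → V) → ℂ) :=
  Algebra.adjoin ℂ (Set.range fun (p : ι × Module.Dual ℂ L) (x : ι → V) => p.2 (x p.1 : L))

section tupleRing

variable {ι κ : Type*}

lemma linear_mem_tupleRing (i : ι) (φ : Module.Dual ℂ L) :
    (fun x : ι → V => φ (x i)) ∈ tupleRing ι V :=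
  Algebra.subset_adjoin ⟨(i, φ), rfl⟩

lemma comp_mem_tupleRing {f : (κ → V) → (ι → V)}
    (hf : ∀ i (φ : Module.Dual ℂ L), (fun z => φ (f z i)) ∈ tupleRing κ V)
    {p : (ι → V) → ℂ} (hp : p ∈ tupleRing ι V) : (fun z => p (f z)) ∈ tupleRing κ V := by
  induction hp using Algebra.adjoin_induction with
  | mem p hp =>
    obtain ⟨⟨i, φ⟩, rfl⟩ := hp
    exact hf i φ
  | algebraMap r => exact Subalgebra.algebraMap_mem _ r
  | add p q _ _ hp hq => exact add_mem hp hq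
  | mul p q _ _ hp hq => exact mul_mem hp hq

lemma slot_mem_tupleRing (i : ι) {f : V → ℂ} (hf : f ∈ coordinateRing V) :
    (fun x : ι → V => f (x i)) ∈ tupleRing ι V := by
  induction hf using Algebra.adjoin_induction with
  | mem f hf =>
    obtain ⟨φ, rfl⟩ := hf
    exact linear_mem_tupleRing i φ
  | algebraMap r => exact Subalgebra.algebraMap_mem _ r
  | add p q _ _ hp hq => exact add_mem hp hq
  | mul p q _ _ hp hq => exact mul_mem hp hq

lemma update_mem_coordinateRing [DecidableEq ι] (a : ι → V) (i : ι) {p : (ι → V) → ℂ}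
    (hp : p ∈ tupleRing ι V) : (fun v => p (update a i v)) ∈ coordinateRing V := by
  induction hp using Algebra.adjoin_induction with
  | mem p hp =>
    obtain ⟨⟨j, φ⟩, rfl⟩ := hp
    by_cases h : j = i
    · subst h
      simp only [update_self]
      exact (linearCoord V φ).2
    · simp only [update_of_ne h]
      exact Subalgebra.algebraMap_mem (coordinateRing V) (φ (a j))
  | algebraMap r => exact Subalgebra.algebraMap_mem _ r
  | add p q _ _ hp hq => exact add_mem hp hq
  | mul p q _ _ hp hq => exact mul_mem hp hq

/-- This is the irreducibility of `V ^ ι`. The tuples `a` and `b` are made to agree one slot at a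
time: with the other slots frozen, `p` and `q` become functions on `V`, and irreducibility of `V`
supplies a common entry. -/
lemma IsIrreducibleAffineCone.exists_tuple_ne_zero [Finite ι] (hV : IsIrreducibleAffineCone V)
    {p q : (ι → V) → ℂ} (hp : p ∈ tupleRing ι V) (hq : q ∈ tupleRing ι V) {a b : ι → V}
    (ha : p a ≠ 0) (hb : q b ≠ 0) : ∃ x, p x ≠ 0 ∧ q x ≠ 0 := by
  classical
  have := Fintype.ofFinite ι
  suffices H : ∀ (S : Finset ι) (a b : ι → V), p a ≠ 0 → q b ≠ 0 → (∀ i ∉ S, a i = b i) →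
      ∃ x, p x ≠ 0 ∧ q x ≠ 0 from H Finset.univ a b ha hb (by simp)
  intro S
  induction S using Finset.induction_on with
  | empty =>
    intro a b ha hb hab
    obtain rfl : a = b := funext fun i => hab i (by simp)
    exact ⟨a, ha, hb⟩
  | insert i S hi ih =>
    intro a b ha hb hab
    obtain ⟨v, hv1, hv2⟩ := hV.exists_ne_zero (update_mem_coordinateRing a i hp)
      (update_mem_coordinateRing b i hq) (a := a i) (b := b i) (by simpa using ha)
      (by simpa using hb)
    refine ih _ _ hv1 hv2 fun j hj => ?_
    by_cases h : j = i
    · subst h; simp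
    · simpa [h] using hab j (by simp [h, hj])

/-- The filter of subsets of `V ^ ι` that contain a nonempty principal Zariski-open set. -/
def genericFilter (ι : Type*) [Finite ι] (hV : IsIrreducibleAffineCone V) : Filter (ι → V) where
  sets := {s | ∃ p ∈ tupleRing ι V, (∃ x, p x ≠ 0) ∧ ∀ x, p x ≠ 0 → x ∈ s}
  univ_sets := by
    obtain ⟨v, hv⟩ := hV.isIrreducible.1
    exact ⟨1, one_mem _, ⟨fun _ => ⟨v, hv⟩, by simp⟩, by simp⟩
  sets_of_superset := by
    rintro s t ⟨p, hp, hne, hps⟩ hst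
    exact ⟨p, hp, hne, fun x hx => hst (hps x hx)⟩
  inter_sets := by
    rintro s t ⟨p, hp, ⟨a, ha⟩, hps⟩ ⟨q, hq, ⟨b, hb⟩, hqt⟩
    obtain ⟨x, hx1, hx2⟩ := hV.exists_tuple_ne_zero hp hq ha hb
    refine ⟨p * q, mul_mem hp hq, ⟨x, by simp [hx1, hx2]⟩, fun x hx => ?_⟩
    simp only [Pi.mul_apply, ne_eq, mul_eq_zero, not_or] at hx
    exact ⟨hps x hx.1, hqt x hx.2⟩

variable [Finite ι] {hV : IsIrreducibleAffineCone V}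

lemma eventually_generic_iff {P : (ι → V) → Prop} :
    (∀ᶠ x in genericFilter ι hV, P x) ↔
      ∃ p ∈ tupleRing ι V, (∃ x, p x ≠ 0) ∧ ∀ x, p x ≠ 0 → P x := Iff.rfl

lemma eventually_generic_of_ne_zero {p : (ι → V) → ℂ} (hp : p ∈ tupleRing ι V) {a : ι → V}
    (ha : p a ≠ 0) : ∀ᶠ x in genericFilter ι hV, p x ≠ 0 :=
  eventually_generic_iff.2 ⟨p, hp, ⟨a, ha⟩, fun _ h => h⟩

instance : (genericFilter ι hV).NeBot := by
  refine ⟨fun h => ?_⟩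
  have h' : ∅ ∈ genericFilter ι hV := by simp [h]
  obtain ⟨p, -, ⟨x, hx⟩, hp⟩ := h'
  exact hp x hx

/-- A polynomial function that vanishes generically vanishes everywhere. -/
lemma eq_zero_of_eventually_generic {p : (ι → V) → ℂ} (hp : p ∈ tupleRing ι V)
    (h : ∀ᶠ x in genericFilter ι hV, p x = 0) (x : ι → V) : p x = 0 := by
  by_contra hx
  obtain ⟨y, hy1, hy2⟩ := (h.and (eventually_generic_of_ne_zero hp hx)).exists
  exact hy2 hy1

/-- A generic property holds generically along a polynomial family that meets the open set on
which it holds. -/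
lemma eventually_generic_comp {f : (ι → V) → (κ → V)}
    (hf : ∀ i (φ : Module.Dual ℂ L), (fun z => φ (f z i)) ∈ tupleRing ι V)
    {p : (κ → V) → ℂ} (hp : p ∈ tupleRing κ V) {z : ι → V} (hz : p (f z) ≠ 0)
    {P : (κ → V) → Prop} (hP : ∀ x, p x ≠ 0 → P x) :
    ∀ᶠ z in genericFilter ι hV, P (f z) :=
  eventually_generic_iff.2 ⟨_, comp_mem_tupleRing hf hp, ⟨z, hz⟩, fun _ h => hP _ h⟩

end tupleRing

end SecantNondefectivity

lemma Finset.eq_map_equivFin {ι : Type*} (S : Finset ι) :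
    S = Finset.univ.map (S.equivFin.symm.toEmbedding.trans (Function.Embedding.subtype _)) := by
  ext i
  simp only [Finset.mem_map, Finset.mem_univ, true_and]
  exact ⟨fun h => ⟨S.equivFin ⟨i, h⟩, by simp⟩, by rintro ⟨a, rfl⟩; exact (S.equivFin.symm a).2⟩

/-! ### Tangent spaces and semicontinuity of their sums -/

namespace SecantNondefectivity

open Filter Function Module

variable {L : Type*} [AddCommGroup L] [Module ℂ L] [FiniteDimensional ℂ L] {V : Set L}

/-- The tangent vector at `x` defined by a derivation of the coordinate ring. -/
noncomputable def tangentMap (x : V) :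
    Derivation ℂ (coordinateRing V) (coordinateRing V) →ₗ[ℂ] L :=
  -- By biduality, the functional `φ ↦ (D φ)(x)` on the dual space is a vector of `L`.
  (evalEquiv ℂ L).symm.toLinearMap ∘ₗ
    { toFun := fun D =>
        { toFun := fun φ => (D (linearCoord V φ) : V → ℂ) x
          map_add' := by simp
          map_smul' := by simp }
      map_add' := fun _ _ => rfl
      map_smul' := fun _ _ => rfl }

lemma apply_tangentMap (φ : Dual ℂ L) (x : V)
    (D : Derivation ℂ (coordinateRing V) (coordinateRing V)) :
    φ (tangentMap x D) = (D (linearCoord V φ) : V → ℂ) x := by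
  rw [tangentMap, LinearMap.comp_apply, LinearEquiv.coe_coe, apply_evalEquiv_symm_apply]
  rfl

/-- The sum of the spaces of tangent vectors at the points `x i` with `i ∈ S`. -/
noncomputable def tangentSum {ι : Type*} (x : ι → V) (S : Finset ι) : Submodule ℂ L :=
  ⨆ i ∈ S, LinearMap.range (tangentMap (x i))

section tangentSum

variable {ι κ : Type*}

lemma tangentSum_eq_span (x : ι → V) (S : Finset ι) :
    tangentSum x S = Submodule.span ℂ {u | ∃ i ∈ S, ∃ D, tangentMap (x i) D = u} := by
  apply le_antisymm
  · refine iSup₂_le fun i hi => ?_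
    rintro _ ⟨D, rfl⟩
    exact Submodule.subset_span ⟨i, hi, D, rfl⟩
  · rw [Submodule.span_le]
    rintro _ ⟨i, hi, D, rfl⟩
    exact (le_iSup₂ (f := fun i (_ : i ∈ S) => LinearMap.range (tangentMap (x i))) i hi) ⟨D, rfl⟩

lemma tangentMap_mem_tangentSum (x : ι → V) {S : Finset ι} {i : ι} (hi : i ∈ S)
    (D : Derivation ℂ (coordinateRing V) (coordinateRing V)) :
    tangentMap (x i) D ∈ tangentSum x S := by
  rw [tangentSum_eq_span]
  exact Submodule.subset_span ⟨i, hi, D, rfl⟩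

lemma tangentSum_mono (x : ι → V) {S S' : Finset ι} (h : S ⊆ S') :
    tangentSum x S ≤ tangentSum x S' :=
  iSup₂_le fun i hi =>
    le_iSup₂ (f := fun i (_ : i ∈ S') => LinearMap.range (tangentMap (x i))) i (h hi)

lemma tangentSum_insert [DecidableEq ι] (x : ι → V) (i : ι) (S : Finset ι) :
    tangentSum x (insert i S) = LinearMap.range (tangentMap (x i)) ⊔ tangentSum x S :=
  Finset.iSup_insert i S _

lemma tangentSum_singleton (x : ι → V) (i : ι) :
    tangentSum x {i} = LinearMap.range (tangentMap (x i)) := by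
  simp [tangentSum]

lemma tangentSum_map (x : ι → V) (f : κ ↪ ι) (S : Finset κ) :
    tangentSum x (S.map f) = tangentSum (x ∘ f) S := by
  classical
  rw [tangentSum, Finset.map_eq_image, Finset.iSup_finset_image]
  rfl

/-- A basis of a sum of tangent spaces that consists of tangent vectors, with dual functionals. -/
lemma exists_tangent_frame (x : ι → V) (S : Finset ι) :
    ∃ (i : Fin (finrank ℂ (tangentSum x S)) → ι)
      (D : Fin (finrank ℂ (tangentSum x S)) →
        Derivation ℂ (coordinateRing V) (coordinateRing V))
      (φ : Fin (finrank ℂ (tangentSum x S)) → Dual ℂ L),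
      (∀ j, i j ∈ S) ∧ ∀ j k, φ k (tangentMap (x (i j)) (D j)) = if j = k then 1 else 0 := by
  rw [tangentSum_eq_span]
  obtain ⟨f, hf, -, hli⟩ := Submodule.exists_fun_fin_finrank_span_eq ℂ
    {u | ∃ i ∈ S, ∃ D, tangentMap (x i) D = u}
  choose i hi D hD using hf
  obtain ⟨g, hg⟩ := LinearMap.exists_leftInverse_of_injective (Fintype.linearCombination ℂ f)
    (LinearMap.ker_eq_bot.2 (hli.fintypeLinearCombination_injective))
  refine ⟨i, D, fun k => LinearMap.proj k ∘ₗ g, hi, fun j k => ?_⟩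
  have := congr_fun (LinearMap.congr_fun hg (Pi.single j 1)) k
  simp only [LinearMap.comp_apply, Fintype.linearCombination_apply_single, one_smul,
    LinearMap.id_apply] at this
  rw [hD, LinearMap.comp_apply, LinearMap.proj_apply, this, Pi.single_apply]
  simp [eq_comm]

lemma mem_tupleRing_det {r : ℕ} (i : Fin r → ι)
    (D : Fin r → Derivation ℂ (coordinateRing V) (coordinateRing V)) (φ : Fin r → Dual ℂ L) :
    (fun x : ι → V => (Matrix.of fun j k => φ k (tangentMap (x (i j)) (D j))).det) ∈
      tupleRing ι V := by
  have hent : ∀ j k, (fun x : ι → V => φ k (tangentMap (x (i j)) (D j))) ∈ tupleRing ι V := by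
    intro j k
    simp only [apply_tangentMap]
    exact slot_mem_tupleRing (i j) (D j (linearCoord V (φ k))).2
  have : (fun x : ι → V => (Matrix.of fun j k => φ k (tangentMap (x (i j)) (D j))).det) =
      ∑ σ : Equiv.Perm (Fin r), ((Equiv.Perm.sign σ : ℤ) : ℂ) •
        ∏ k, fun x : ι → V => φ k (tangentMap (x (i (σ k))) (D (σ k))) := by
    ext x
    simp [Matrix.det_apply']
  rw [this]
  exact sum_mem fun σ _ => Subalgebra.smul_mem _ (prod_mem fun k _ => hent _ _) _

/-- The dimension of the sum of the tangent spaces is lower semicontinuous. -/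
lemma eventually_finrank_tangentSum_le [Finite ι] (hV : IsIrreducibleAffineCone V) (a : ι → V)
    (S : Finset ι) : ∀ᶠ x in genericFilter ι hV,
      finrank ℂ (tangentSum a S) ≤ finrank ℂ (tangentSum x S) := by
  obtain ⟨i, D, φ, hi, h⟩ := exists_tangent_frame a S
  -- The determinant of the frame is polynomial in the points and equals `1` at `a`. Where it does
  -- not vanish, the same derivations still give independent tangent vectors.
  refine (eventually_generic_of_ne_zero (mem_tupleRing_det i D φ) (a := a) ?_).mono fun x hx => ?_
  · have : (Matrix.of fun j k => φ k (tangentMap (a (i j)) (D j))) = 1 := by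
      ext j k
      simp [h, Matrix.one_apply]
    simp [this]
  · have hli : LinearIndependent ℂ fun j => tangentMap (x (i j)) (D j) := by
      have := Matrix.linearIndependent_rows_of_det_ne_zero hx
      exact LinearIndependent.of_comp (LinearMap.pi φ) this
    have hli' : LinearIndependent ℂ fun j =>
        (⟨tangentMap (x (i j)) (D j), tangentMap_mem_tangentSum x (hi j) (D j)⟩ :
          tangentSum x S) :=
      LinearIndependent.of_comp (Submodule.subtype _) hli
    simpa using hli'.fintype_card_le_finrank

end tangentSum

/-- The maximal dimension of the sum of the tangent spaces at `m` points of `V`. -/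
noncomputable def tangentRank (V : Set L) (m : ℕ) : ℕ :=
  sSup (Set.range fun x : Fin m → V => finrank ℂ (tangentSum x Finset.univ))

section tangentRank

variable {ι : Type*}

lemma bddAbove_finrank_tangentSum (V : Set L) (m : ℕ) :
    BddAbove (Set.range fun x : Fin m → V => finrank ℂ (tangentSum x Finset.univ)) :=
  ⟨finrank ℂ L, by rintro _ ⟨x, rfl⟩; exact Submodule.finrank_le _⟩

lemma tangentRank_le_finrank (V : Set L) (m : ℕ) : tangentRank V m ≤ finrank ℂ L := by
  rcases isEmpty_or_nonempty (Fin m → V) with h | h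
  · simp [tangentRank, Set.range_eq_empty]
  · apply csSup_le (Set.range_nonempty _)
    rintro _ ⟨x, rfl⟩
    exact Submodule.finrank_le _

lemma exists_finrank_tangentSum_eq (hV : V.Nonempty) (m : ℕ) :
    ∃ x : Fin m → V, finrank ℂ (tangentSum x Finset.univ) = tangentRank V m := by
  have : Nonempty V := hV.to_subtype
  exact Nat.sSup_mem (Set.range_nonempty _) (bddAbove_finrank_tangentSum V m)

lemma finrank_tangentSum_le (x : ι → V) (S : Finset ι) :
    finrank ℂ (tangentSum x S) ≤ tangentRank V S.card := by
  have : S = Finset.univ.map (S.equivFin.symm.toEmbedding.trans (Embedding.subtype _)) :=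
    S.eq_map_equivFin
  conv_lhs => rw [this, tangentSum_map]
  exact le_csSup (bddAbove_finrank_tangentSum V _) ⟨_, rfl⟩

/-- A tuple attaining the maximum is placed on the indices in `S`, and semicontinuity spreads its
rank to general tuples. The entries outside `S` do not matter, so any point of `V` serves there. -/
lemma eventually_finrank_tangentSum_eq [Finite ι] (hV : IsIrreducibleAffineCone V)
    (S : Finset ι) : ∀ᶠ x in genericFilter ι hV,
      finrank ℂ (tangentSum x S) = tangentRank V S.card := by
  classical
  have hne : V.Nonempty := hV.isIrreducible.1
  obtain ⟨z, hz⟩ := exists_finrank_tangentSum_eq hne S.card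
  let a : ι → V := fun i => if h : i ∈ S then z (S.equivFin ⟨i, h⟩) else ⟨_, hne.some_mem⟩
  have ha : finrank ℂ (tangentSum a S) = tangentRank V S.card := by
    have : S = Finset.univ.map (S.equivFin.symm.toEmbedding.trans (Embedding.subtype _)) :=
    S.eq_map_equivFin
    have h2 : a ∘ (S.equivFin.symm.toEmbedding.trans (Embedding.subtype _)) = z := by
      ext k
      simp [a]
    conv_lhs => rw [this, tangentSum_map, h2]
    exact hz
  filter_upwards [eventually_finrank_tangentSum_le hV a S] with x hx
  exact le_antisymm (finrank_tangentSum_le x S) (ha ▸ hx)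

lemma eventually_forall_finrank_tangentSum_eq (ι : Type*) [Finite ι]
    (hV : IsIrreducibleAffineCone V) : ∀ᶠ x in genericFilter ι hV,
      ∀ S : Finset ι, finrank ℂ (tangentSum x S) = tangentRank V S.card :=
  eventually_all.2 fun S => eventually_finrank_tangentSum_eq hV S

end tangentRank

end SecantNondefectivity

/-! ### Partial derivatives of polynomials -/

namespace MvPolynomial

/-- The chain rule for derivations. -/
lemma derivation_aeval {R A M σ : Type*} [CommRing R] [CommRing A] [Algebra R A] [AddCommGroup M]
    [Module A M] [Module R M] [Fintype σ] (D : Derivation R A M) (f : σ → A)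
    (P : MvPolynomial σ R) :
    D (aeval f P) = ∑ k, aeval f (pderiv k P) • D (f k) := by
  classical
  induction P using MvPolynomial.induction_on with
  | C r => simp
  | add p q hp hq => simp [hp, hq, add_smul, Finset.sum_add_distrib]
  | mul_X p i hp =>
    simp only [map_mul, aeval_X, Derivation.leibniz, hp, pderiv_X, smul_eq_mul, map_add, add_smul,
      Finset.sum_add_distrib, Finset.smul_sum, smul_smul]
    congr 1
    rw [Finset.sum_eq_single i]
    · simp
    · intro k _ hk
      simp [hk.symm]
    · simp

lemma totalDegree_pderiv_lt_of_ne_zero {K σ : Type*} [Field K] {P : MvPolynomial σ K} {k : σ}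
    (h : pderiv k P ≠ 0) : (pderiv k P).totalDegree < P.totalDegree := by
  obtain ⟨m, hm, hdeg⟩ := Finset.exists_mem_eq_sup _ (support_nonempty.2 h)
    fun s : σ →₀ ℕ => s.sum fun _ e => e
  rw [mem_support_iff, coeff_pderiv] at hm
  have hm' : m + Finsupp.single k 1 ∈ P.support := mem_support_iff.2 (left_ne_zero_of_mul hm)
  have := le_totalDegree hm'
  rw [Finsupp.sum_add_index' (by simp) (by simp), Finsupp.sum_single_index rfl] at this
  rw [totalDegree, hdeg]
  omega

/-- In characteristic zero, a set of polynomials that is closed under partial derivatives and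
contains a nonzero polynomial contains a nonzero constant. -/
lemma exists_C_mem_of_pderiv_mem {K σ : Type*} [Field K] [CharZero K] {I : Set (MvPolynomial σ K)}
    (hI : ∀ P ∈ I, ∀ k, pderiv k P ∈ I) {P : MvPolynomial σ K} (hP : P ∈ I) (h0 : P ≠ 0) :
    ∃ c : K, c ≠ 0 ∧ C c ∈ I := by
  classical
  induction hn : P.totalDegree using Nat.strong_induction_on generalizing P with
  | _ n ih =>
    by_cases h : ∃ k, pderiv k P ≠ 0
    · obtain ⟨k, hk⟩ := h
      exact ih _ (hn ▸ totalDegree_pderiv_lt_of_ne_zero hk) (hI P hP k) hk rfl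
    · push Not at h
      -- A nonconstant monomial with exponent `m k ≠ 0` contributes `m k` times its coefficient to
      -- `pderiv k P`, so characteristic zero kills that coefficient.
      have hPC : P = C (coeff 0 P) := by
        ext m
        rw [coeff_C]
        split_ifs with hm
        · rw [hm]
        · obtain ⟨k, hk⟩ : ∃ k, m k ≠ 0 := by
            by_contra! hc
            exact hm (Finsupp.ext fun k => (hc k).symm)
          have h1 := congr_arg (coeff (m - Finsupp.single k 1)) (h k)
          rw [coeff_pderiv, coeff_zero, tsub_add_cancel_of_le
            (Finsupp.single_le_iff.2 (Nat.one_le_iff_ne_zero.2 hk))] at h1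
          exact (mul_eq_zero.1 h1).resolve_right (Nat.cast_add_one_ne_zero _)
      refine ⟨coeff 0 P, fun hc => h0 ?_, hPC ▸ hP⟩
      rw [hPC, hc, C_0]

end MvPolynomial

/-! ### Polynomial relations between sums of points, and half of Terracini's lemma -/

namespace SecantNondefectivity

open Filter Function Module

variable {L : Type*} [AddCommGroup L] [Module ℂ L] {V : Set L}

lemma sum_mem_secantVariety {m : ℕ} (x : Fin m → V) : ∑ i, (x i : L) ∈ secantVariety m V :=
  @subset_closure L (zariskiTopology L) _ _ ⟨fun i => x i, fun i => (x i).2, rfl⟩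

lemma exists_eval_eq_of_mem_polynomialFunctions {σ : Type*} {φ : σ → Dual ℂ L}
    (hφ : Submodule.span ℂ (Set.range φ) = ⊤) {F : L → ℂ} (hF : F ∈ polynomialFunctions L) :
    ∃ P : MvPolynomial σ ℂ, ∀ y, F y = MvPolynomial.eval (fun k => φ k y) P := by
  let l : Dual ℂ L →ₗ[ℂ] (L → ℂ) :=
    { toFun := fun φ v => φ v
      map_add' := fun _ _ => rfl
      map_smul' := fun _ _ => rfl }
  have : polynomialFunctions L = Algebra.adjoin ℂ (Set.range (l ∘ φ)) := by
    rw [← Algebra.adjoin_span (R := ℂ) (s := Set.range (l ∘ φ)), Set.range_comp,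
      Submodule.span_image, hφ, Submodule.map_top]
    rfl
  rw [this, Algebra.adjoin_range_eq_range_aeval] at hF
  obtain ⟨P, rfl⟩ := hF
  refine ⟨P, fun y => ?_⟩
  change Pi.evalAlgHom ℂ (fun _ : L => ℂ) y (MvPolynomial.aeval (l ∘ φ) P) = _
  rw [MvPolynomial.comp_aeval_apply]
  rfl

/-- Evaluation of elements of the coordinate ring at a point. -/
def evalPoint (v : V) : coordinateRing V →ₐ[ℂ] ℂ :=
  (Pi.evalAlgHom ℂ (fun _ : V => ℂ) v).comp (coordinateRing V).val

lemma evalPoint_apply (v : V) (f : coordinateRing V) : evalPoint v f = (f : V → ℂ) v := rfl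

lemma evalPoint_aeval {σ : Type*} (v : V) (f : σ → coordinateRing V) (P : MvPolynomial σ ℂ) :
    evalPoint v (MvPolynomial.aeval f P) =
      MvPolynomial.eval (fun k => (f k : V → ℂ) v) P := by
  rw [MvPolynomial.comp_aeval_apply]
  rfl

lemma sum_apply_mem_tupleRing {ι : Type*} [Fintype ι] {σ : Type*} (φ : σ → Dual ℂ L)
    (P : MvPolynomial σ ℂ) :
    (fun x : ι → V => MvPolynomial.eval (fun k => ∑ i, φ k (x i)) P) ∈ tupleRing ι V := by
  induction P using MvPolynomial.induction_on with
  | C r =>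
    simp only [MvPolynomial.eval_C]
    exact Subalgebra.algebraMap_mem (tupleRing ι V) r
  | add p q hp hq =>
    simp only [map_add]
    exact add_mem hp hq
  | mul_X p k hp =>
    simp only [map_mul, MvPolynomial.eval_X]
    refine mul_mem hp ?_
    have := sum_mem (S := tupleRing ι V) (t := Finset.univ)
      fun i _ => linear_mem_tupleRing (V := V) i (φ k)
    convert this using 1
    ext x
    simp

variable [FiniteDimensional ℂ L]

/-- The derivative of a polynomial relation between sums of linear functionals on `V ^ ι` along a
tangent vector in one of the factors. -/
lemma sum_eval_pderiv_mul_eq_zero {ι σ : Type*} [Fintype ι] [Fintype σ] (φ : σ → Dual ℂ L)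
    {P : MvPolynomial σ ℂ}
    (hP : ∀ x : ι → V, MvPolynomial.eval (fun k => ∑ i, φ k (x i)) P = 0) (x : ι → V) (i : ι)
    (D : Derivation ℂ (coordinateRing V) (coordinateRing V)) :
    ∑ k, φ k (tangentMap (x i) D) *
      MvPolynomial.eval (fun k => ∑ i, φ k (x i)) (MvPolynomial.pderiv k P) = 0 := by
  classical
  -- All points but the `i`-th are frozen, which turns the relation into one in the coordinate ring
  -- of `V`, where `D` and the chain rule apply.
  let f : σ → coordinateRing V := fun k =>
    linearCoord V (φ k) + algebraMap ℂ _ (∑ i' ∈ Finset.univ.erase i, φ k (x i'))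
  have hf : ∀ k v, (f k : V → ℂ) v = ∑ i', φ k (update x i v i') := by
    intro k v
    rw [← Finset.add_sum_erase _ _ (Finset.mem_univ i), update_self]
    change φ k v + ∑ i' ∈ Finset.univ.erase i, φ k (x i') = _
    congr 1
    exact Finset.sum_congr rfl fun j hj => by rw [update_of_ne (Finset.ne_of_mem_erase hj)]
  have h0 : MvPolynomial.aeval f P = 0 := by
    ext v
    change evalPoint v _ = 0
    rw [evalPoint_aeval]
    simp only [hf]
    exact hP _
  have h1 := congr_arg (evalPoint (x i)) (MvPolynomial.derivation_aeval D f P)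
  rw [h0, map_zero, map_zero, map_sum] at h1
  rw [h1]
  refine Finset.sum_congr rfl fun k _ => ?_
  rw [smul_eq_mul, map_mul, evalPoint_aeval, mul_comm, apply_tangentMap]
  congr 1
  · simp [hf]
  · simp [f, evalPoint_apply]

/-- Functionals that restrict to linearly independent functionals on a sum of tangent spaces are
algebraically independent as functions of the sum of the points. -/
lemma eq_zero_of_eval_sum_eq_zero (hV : IsIrreducibleAffineCone V) {ι : Type*} [Fintype ι] {r : ℕ}
    (i : Fin r → ι) (D : Fin r → Derivation ℂ (coordinateRing V) (coordinateRing V))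
    (φ : Fin r → Dual ℂ L) (a : ι → V)
    (h : ∀ j k, φ k (tangentMap (a (i j)) (D j)) = if j = k then 1 else 0)
    {P : MvPolynomial (Fin r) ℂ}
    (hP : ∀ x : ι → V, MvPolynomial.eval (fun k => ∑ i, φ k (x i)) P = 0) : P = 0 := by
  by_contra hP0
  have hI : ∀ P ∈ {P : MvPolynomial (Fin r) ℂ |
      ∀ x : ι → V, MvPolynomial.eval (fun k => ∑ i, φ k (x i)) P = 0}, ∀ k,
      MvPolynomial.pderiv k P ∈ {P : MvPolynomial (Fin r) ℂ |
        ∀ x : ι → V, MvPolynomial.eval (fun k => ∑ i, φ k (x i)) P = 0} := by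
    intro P hP k
    have ha : (Matrix.of fun j k => φ k (tangentMap (a (i j)) (D j))).det ≠ 0 := by
      have : (Matrix.of fun j k => φ k (tangentMap (a (i j)) (D j))) = 1 := by
        ext j k
        simp [h, Matrix.one_apply]
      simp [this]
    -- The gradient of `P` is in the kernel of the frame matrix, which is invertible at general
    -- points. So the partial derivatives vanish generically, hence everywhere, and relations are
    -- closed under differentiation.
    refine eq_zero_of_eventually_generic (hV := hV) (sum_apply_mem_tupleRing φ _)
      ((eventually_generic_of_ne_zero (mem_tupleRing_det i D φ) ha).mono fun x hx => ?_)
    exact congr_fun (Matrix.eq_zero_of_mulVec_eq_zero hx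
      (v := fun k => MvPolynomial.eval (fun k => ∑ i, φ k (x i)) (MvPolynomial.pderiv k P))
      (funext fun j => sum_eval_pderiv_mul_eq_zero φ hP x (i j) (D j))) k
  obtain ⟨c, hc, hcI⟩ := MvPolynomial.exists_C_mem_of_pderiv_mem hI hP hP0
  exact hc (by simpa using hcI a)

instance finiteType_coordinateRing (V : Set L) : Algebra.FiniteType ℂ (coordinateRing V) := by
  refine (Subalgebra.fg_iff_finiteType _).1 ?_
  let b := finBasis ℂ (Dual ℂ L)
  let l : Dual ℂ L →ₗ[ℂ] (V → ℂ) :=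
    { toFun := fun φ v => φ v
      map_add' := fun _ _ => rfl
      map_smul' := fun _ _ => rfl }
  have : coordinateRing V = Algebra.adjoin ℂ (Set.range (l ∘ b)) := by
    rw [← Algebra.adjoin_span (R := ℂ) (s := Set.range (l ∘ b)), Set.range_comp,
      Submodule.span_image, b.span_eq, Submodule.map_top]
    rfl
  rw [this]
  exact ⟨(Set.finite_range (l ∘ b)).toFinset, by simp⟩

lemma le_varietyDim_of_algebraicIndependent {r : ℕ} {f : Fin r → coordinateRing V}
    (hf : AlgebraicIndependent ℂ f) : r ≤ varietyDim V := by
  have h := hf.lift_cardinalMk_le_trdeg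
  rw [varietyDim, ← Cardinal.toNat_lift.{0}]
  have h2 := Cardinal.toNat_le_toNat h
    (Cardinal.lift_lt_aleph0.2 (trdeg_lt_aleph0_of_finiteType))
  simpa using h2

/-- One half of Terracini's lemma. -/
theorem tangentRank_le_varietyDim (hV : IsIrreducibleAffineCone V) (m : ℕ) :
    tangentRank V m ≤ varietyDim (secantVariety m V) := by
  obtain ⟨a, ha⟩ := exists_finrank_tangentSum_eq hV.isIrreducible.1 m
  obtain ⟨i, D, φ, -, h⟩ := exists_tangent_frame a Finset.univ
  rw [← ha]
  refine le_varietyDim_of_algebraicIndependent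
    (f := fun k => linearCoord (secantVariety m V) (φ k)) ?_
  rw [algebraicIndependent_iff]
  intro P hP
  refine eq_zero_of_eval_sum_eq_zero hV i D φ a h fun x => ?_
  have := congr_arg (evalPoint ⟨_, sum_mem_secantVariety x⟩) hP
  rw [evalPoint_aeval] at this
  simpa using this

/-- At full rank the functionals dual to a tangent frame are linear coordinates on `L`. Every
polynomial function is a polynomial in them, and it is zero if it vanishes on all sums. -/
theorem secantVariety_eq_univ (hV : IsIrreducibleAffineCone V) {m : ℕ}
    (hm : tangentRank V m = finrank ℂ L) : secantVariety m V = Set.univ := by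
  obtain ⟨a, ha⟩ := exists_finrank_tangentSum_eq hV.isIrreducible.1 m
  obtain ⟨i, D, φ, -, h⟩ := exists_tangent_frame a Finset.univ
  have hli : LinearIndependent ℂ φ := by
    rw [Fintype.linearIndependent_iff]
    intro g hg j
    have := LinearMap.congr_fun hg (tangentMap (a (i j)) (D j))
    simpa [h] using this
  have hspan : Submodule.span ℂ (Set.range φ) = ⊤ :=
    hli.span_eq_top_of_card_eq_finrank' (by simp [ha, hm])
  refine Set.eq_univ_of_forall fun y => mem_zariski_closure_iff.2 fun F hF hs => ?_
  obtain ⟨P, hP⟩ := exists_eval_eq_of_mem_polynomialFunctions hspan hF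
  have : P = 0 := eq_zero_of_eval_sum_eq_zero hV i D φ a h fun x => by
    have := hs _ ⟨fun i => x i, fun i => (x i).2, rfl⟩
    rw [hP] at this
    simpa using this
  rw [hP, this, map_zero]

end SecantNondefectivity

/-! ### Derivations from transcendence bases, and the dimension of a general tangent space -/

section

open Filter Function Module

section Derivation

open TensorProduct in
/-- Derivations extend along formally étale algebras. -/
lemma Derivation.exists_extend_of_formallyEtale {R S T M : Type*} [CommRing R] [CommRing S]
    [CommRing T] [Algebra R S] [Algebra R T] [Algebra S T] [IsScalarTower R S T]
    [Algebra.FormallyEtale S T] [AddCommGroup M] [Module R M] [Module S M] [Module T M]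
    [IsScalarTower R S M] [IsScalarTower S T M] [IsScalarTower R T M] (d : Derivation R S M) :
    ∃ D : Derivation R T M, ∀ s, D (algebraMap S T s) = d s := by
  -- For `S → T` formally étale, `T ⊗[S] Ω[S⁄R]` is `Ω[T⁄R]`, so the linear map induced by `d`
  -- already defines a derivation of `T`.
  let l : T ⊗[S] Ω[S⁄R] →ₗ[T] M := LinearMap.liftBaseChange T d.liftKaehlerDifferential
  refine ⟨(l ∘ₗ
    (KaehlerDifferential.tensorKaehlerEquivOfFormallyEtale R S T).symm.toLinearMap).compDer
      (KaehlerDifferential.D R T), fun s => ?_⟩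
  simp [l, KaehlerDifferential.tensorKaehlerEquivOfFormallyEtale_symm_D_algebraMap]

open scoped IntermediateField.algebraAdjoinAdjoin in
/-- In characteristic zero, the partial derivatives with respect to a transcendence basis extend
to derivations. -/
lemma IsTranscendenceBasis.exists_derivation {k K ι : Type*} [Field k] [CharZero k] [Field K]
    [Algebra k K] {t : ι → K} (ht : IsTranscendenceBasis k t) (c : ι → K) :
    ∃ D : Derivation k K K, ∀ i, D (t i) = c i := by
  -- In characteristic zero `K` is separable algebraic over `k(t)`, which is a localization of
  -- `k[t]`. So `K` is formally étale over `k[t]`, a polynomial ring whose derivations can be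
  -- prescribed on the variables.
  have : Algebra.IsAlgebraic (IntermediateField.adjoin k (Set.range t)) K := ht.isAlgebraic_field
  have : CharZero (IntermediateField.adjoin k (Set.range t)) :=
    charZero_of_injective_algebraMap (algebraMap k _).injective
  have : Algebra.FormallyEtale (IntermediateField.adjoin k (Set.range t)) K :=
    Algebra.FormallyEtale.of_isSeparable _ K
  have : Algebra.FormallyEtale (Algebra.adjoin k (Set.range t))
      (IntermediateField.adjoin k (Set.range t)) :=
    .of_isLocalization (nonZeroDivisors _)
  have : Algebra.FormallyEtale (Algebra.adjoin k (Set.range t)) K :=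
    .comp _ (IntermediateField.adjoin k (Set.range t)) _
  let e := ht.1.aevalEquiv
  let _ : Algebra (MvPolynomial ι k) K := (MvPolynomial.aeval t).toRingHom.toAlgebra
  have : IsScalarTower k (MvPolynomial ι k) K :=
    .of_algebraMap_eq fun r => (MvPolynomial.aeval t).commutes r |>.symm
  have he : ∀ (a : Algebra.adjoin k (Set.range t)) (x : K), e.symm a • x = a • x := by
    intro a x
    rw [Algebra.smul_def, Algebra.smul_def]
    congr 1
    have := ht.1.algebraMap_aevalEquiv (e.symm a)
    rw [AlgEquiv.apply_symm_apply] at this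
    exact this.symm
  let d₀ : Derivation k (MvPolynomial ι k) K := MvPolynomial.mkDerivation k c
  let d : Derivation k (Algebra.adjoin k (Set.range t)) K :=
    { d₀.toLinearMap ∘ₗ e.symm.toLinearMap with
      map_one_eq_zero' := by simp
      leibniz' := fun a b => by simp [he] }
  obtain ⟨D, hD⟩ := Derivation.exists_extend_of_formallyEtale (T := K) d
  refine ⟨D, fun i => ?_⟩
  have h1 : e (MvPolynomial.X i) = ⟨t i, Algebra.subset_adjoin ⟨i, rfl⟩⟩ :=
    Subtype.ext ((ht.1.algebraMap_aevalEquiv (MvPolynomial.X i)).trans (MvPolynomial.aeval_X t i))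
  have h2 := hD ⟨t i, Algebra.subset_adjoin ⟨i, rfl⟩⟩
  refine h2.trans ?_
  rw [← h1]
  change d₀ (e.symm (e _)) = _
  rw [AlgEquiv.symm_apply_apply]
  exact MvPolynomial.mkDerivation_X k c i

/-- Denominators of a derivation on a finitely generated algebra can be cleared. -/
lemma Derivation.exists_smul_eq_algebraMap {k A K : Type*} [CommRing k] [CommRing A] [IsDomain A]
    [Field K] [Algebra k A] [Algebra k K] [Algebra A K] [IsScalarTower k A K]
    [IsFractionRing A K] [Algebra.FiniteType k A] (D : Derivation k K K) :
    ∃ h : A, h ≠ 0 ∧ ∃ D' : Derivation k A A,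
      ∀ a, algebraMap A K (D' a) = algebraMap A K h * D (algebraMap A K a) := by
  obtain ⟨s, hs⟩ := ‹Algebra.FiniteType k A›.out
  classical
  -- `h` is a common denominator for the values of `D` on the generators. By the Leibniz rule `h *
  -- D` then maps all of `A` into `A`.
  obtain ⟨⟨h, hh⟩, hint⟩ := IsLocalization.exist_integer_multiples_of_finset (nonZeroDivisors A)
    (s.image fun a => D (algebraMap A K a))
  have key : ∀ a : A, ∃ b, algebraMap A K b = algebraMap A K h * D (algebraMap A K a) := by
    intro a
    have ha : a ∈ Algebra.adjoin k (s : Set A) := hs ▸ Algebra.mem_top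
    induction ha using Algebra.adjoin_induction with
    | mem a ha =>
      obtain ⟨b, hb⟩ := hint _ (Finset.mem_image_of_mem _ ha)
      exact ⟨b, hb.trans (Algebra.smul_def _ _)⟩
    | algebraMap r =>
      refine ⟨0, ?_⟩
      rw [← IsScalarTower.algebraMap_apply]
      simp
    | add a b _ _ ha hb =>
      obtain ⟨a', ha⟩ := ha
      obtain ⟨b', hb⟩ := hb
      exact ⟨a' + b', by simp [ha, hb, mul_add]⟩
    | mul a b _ _ ha hb =>
      obtain ⟨a', ha⟩ := ha
      obtain ⟨b', hb⟩ := hb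
      refine ⟨a * b' + b * a', ?_⟩
      simp only [map_add, map_mul, ha, hb, Derivation.leibniz, smul_eq_mul]
      ring
  choose f hf using key
  have hinj := IsFractionRing.injective A K
  refine ⟨h, nonZeroDivisors.ne_zero hh,
    { toFun := f
      map_add' := fun a b => hinj (by simp [hf, mul_add])
      map_smul' := fun r a => hinj ?_
      map_one_eq_zero' := hinj (by simp [hf])
      leibniz' := fun a b => hinj ?_ }, hf⟩
  · simp [hf, Algebra.smul_def, ← IsScalarTower.algebraMap_apply k A K]
    ring
  · simp only [LinearMap.coe_mk, AddHom.coe_mk, hf, map_mul, Derivation.leibniz, smul_eq_mul,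
      map_add]
    ring

/-- On a finitely generated domain in characteristic zero there are derivations that are, up to
nonzero factors, dual to a given transcendence basis. -/
lemma IsTranscendenceBasis.exists_dual_derivations {k A ι : Type*} [Field k] [CharZero k]
    [CommRing A] [IsDomain A] [Algebra k A] [Algebra.FiniteType k A] [DecidableEq ι] {t : ι → A}
    (ht : IsTranscendenceBasis k t) :
    ∃ (h : ι → A) (D : ι → Derivation k A A), (∀ i, h i ≠ 0) ∧
      ∀ i j, D i (t j) = if i = j then h i else 0 := by
  have : Algebra.IsAlgebraic A (FractionRing A) :=
    IsLocalization.isAlgebraic (FractionRing A) (nonZeroDivisors A)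
  choose D hD using fun i : ι =>
    (ht.algebraMap_comp (A := FractionRing A)).exists_derivation (Pi.single i 1)
  choose h hh D' hD' using fun i => (D i).exists_smul_eq_algebraMap (A := A)
  refine ⟨h, D', hh, fun i j => IsFractionRing.injective A (FractionRing A) ?_⟩
  have := hD i j
  rw [Function.comp_apply] at this
  rw [hD', this]
  split_ifs with hij
  · simp [hij]
  · simp [Ne.symm hij]

end Derivation

namespace SecantNondefectivity

variable {L : Type*} [AddCommGroup L] [Module ℂ L] {V : Set L}

lemma IsIrreducibleAffineCone.isDomain (hV : IsIrreducibleAffineCone V) :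
    IsDomain (coordinateRing V) := by
  obtain ⟨v, hv⟩ := hV.isIrreducible.1
  have : Nonempty V := ⟨⟨v, hv⟩⟩
  have : NoZeroDivisors (coordinateRing V) := by
    refine ⟨fun {f g} hfg => ?_⟩
    by_contra! h
    obtain ⟨a, ha⟩ : ∃ a, (f : V → ℂ) a ≠ 0 := by
      by_contra! hc
      exact h.1 (Subtype.ext (funext hc))
    obtain ⟨b, hb⟩ : ∃ a, (g : V → ℂ) a ≠ 0 := by
      by_contra! hc
      exact h.2 (Subtype.ext (funext hc))
    obtain ⟨v, hv1, hv2⟩ := hV.exists_ne_zero f.2 g.2 ha hb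
    have := congr_arg (evalPoint v) hfg
    rw [map_mul, map_zero] at this
    exact (mul_ne_zero hv1 hv2) this
  exact NoZeroDivisors.to_isDomain _

lemma IsIrreducibleAffineCone.isDomain_tupleRing (hV : IsIrreducibleAffineCone V) (ι : Type*)
    [Finite ι] : IsDomain (tupleRing ι V) := by
  obtain ⟨v, hv⟩ := hV.isIrreducible.1
  have : Nonempty V := ⟨⟨v, hv⟩⟩
  have : NoZeroDivisors (tupleRing ι V) := by
    refine ⟨fun {f g} hfg => ?_⟩
    by_contra! h
    obtain ⟨a, ha⟩ : ∃ a, (f : (ι → V) → ℂ) a ≠ 0 := by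
      by_contra! hc
      exact h.1 (Subtype.ext (funext hc))
    obtain ⟨b, hb⟩ : ∃ a, (g : (ι → V) → ℂ) a ≠ 0 := by
      by_contra! hc
      exact h.2 (Subtype.ext (funext hc))
    obtain ⟨x, hx1, hx2⟩ := hV.exists_tuple_ne_zero f.2 g.2 ha hb
    exact mul_ne_zero hx1 hx2 (congr_fun (congr_arg Subtype.val hfg) x)
  exact NoZeroDivisors.to_isDomain _

variable [FiniteDimensional ℂ L]

/-- The linear functionals generate the coordinate ring, so the Leibniz rule determines a derivation
at `x` from its tangent vector. -/
lemma evalPoint_eq_zero_of_tangentMap_eq_zero {x : V}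
    {D : Derivation ℂ (coordinateRing V) (coordinateRing V)} (hD : tangentMap x D = 0)
    (f : coordinateRing V) : evalPoint x (D f) = 0 := by
  have hf : f ∈ Algebra.adjoin ℂ (Set.range (linearCoord V)) := by
    rw [adjoin_range_linearCoord]
    exact Algebra.mem_top
  induction hf using Algebra.adjoin_induction with
  | mem f hf =>
    obtain ⟨φ, rfl⟩ := hf
    rw [evalPoint_apply, ← apply_tangentMap, hD, map_zero]
  | algebraMap r => rw [Derivation.map_algebraMap, map_zero]
  | add f g _ _ hf hg => rw [map_add, map_add, hf, hg, add_zero]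
  | mul f g _ _ hf hg =>
    rw [Derivation.leibniz, map_add, smul_eq_mul, smul_eq_mul, map_mul, map_mul, hf, hg, mul_zero,
      mul_zero, add_zero]

lemma exists_isTranscendenceBasis_coordinateRing (hV : IsIrreducibleAffineCone V) :
    ∃ t : Fin (varietyDim V) → coordinateRing V, IsTranscendenceBasis ℂ t := by
  have := hV.isDomain
  have : FaithfulSMul ℂ (coordinateRing V) :=
    (faithfulSMul_iff_algebraMap_injective _ _).2 (algebraMap ℂ (coordinateRing V)).injective
  obtain ⟨s, hs⟩ := exists_isTranscendenceBasis ℂ (coordinateRing V)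
  have hc := hs.cardinalMk_eq_trdeg
  have hfin : Cardinal.mk s < Cardinal.aleph0 := hc ▸ trdeg_lt_aleph0_of_finiteType
  have := (Cardinal.lt_aleph0_iff_fintype.1 hfin).some
  have hcard : Fintype.card s = varietyDim V := by
    rw [varietyDim, ← hc, Cardinal.mk_toNat_eq_card]
  exact ⟨_, hs.comp_equiv (Fintype.equivFinOfCardEq hcard).symm⟩

/-- The dimension of `V` is attained by the tangent vectors at some point. -/
theorem varietyDim_le_tangentRank_one (hV : IsIrreducibleAffineCone V) :
    varietyDim V ≤ tangentRank V 1 := by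
  have := hV.isDomain
  obtain ⟨t, ht⟩ := exists_isTranscendenceBasis_coordinateRing hV
  obtain ⟨h, D', hh, hval⟩ := ht.exists_dual_derivations
  have hprod : ∏ i, h i ≠ 0 := Finset.prod_ne_zero_iff.2 fun i _ => hh i
  obtain ⟨x, hx⟩ : ∃ x, (∏ i, evalPoint x (h i)) ≠ 0 := by
    by_contra! hc
    refine hprod (Subtype.ext (funext fun x => ?_))
    have := hc x
    rw [← map_prod] at this
    exact this
  have hx' : ∀ i, evalPoint x (h i) ≠ 0 := fun i => Finset.prod_ne_zero_iff.1 hx i (by simp)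
  have hli : LinearIndependent ℂ fun i => tangentMap x (D' i) := by
    rw [Fintype.linearIndependent_iff]
    intro c hc i
    -- A linear relation between the tangent vectors gives a derivation that vanishes at `x`.
    -- Applied to `t i` it yields `c i * h i (x) = 0`, and `x` was chosen off the zeros of every `h
    -- i`.
    have hc' : tangentMap x (∑ i, c i • D' i) = 0 := by simpa using hc
    have := evalPoint_eq_zero_of_tangentMap_eq_zero hc' (t i)
    have hsum : (∑ j, c j • D' j) (t i) = c i • h i := by
      rw [← Derivation.coeFnAddMonoidHom_apply, map_sum, Finset.sum_apply]
      simp only [Derivation.coeFnAddMonoidHom_apply, Derivation.smul_apply, hval]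
      simp
    rw [hsum, map_smul, smul_eq_mul] at this
    exact (mul_eq_zero.1 this).resolve_right (hx' i)
  have hle : varietyDim V ≤ finrank ℂ (tangentSum (fun _ : Fin 1 => x) Finset.univ) := by
    have hli' : LinearIndependent ℂ fun i =>
        (⟨tangentMap x (D' i), tangentMap_mem_tangentSum (fun _ : Fin 1 => x)
          (Finset.mem_univ 0) (D' i)⟩ : tangentSum (fun _ : Fin 1 => x) Finset.univ) :=
      LinearIndependent.of_comp (Submodule.subtype _) hli
    simpa using hli'.fintype_card_le_finrank
  simpa using hle.trans (finrank_tangentSum_le _ _)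

end SecantNondefectivity

end

/-! ### Transcendence degree of powers of `V`, and the lower bound on the generic rank -/

section

open Filter Function Module

/-- The transcendence degree of a domain generated by finitely many copies of an algebra. -/
lemma Algebra.trdeg_le_of_adjoin_iUnion_range {k A C ι κ : Type*} [Field k] [CommRing A]
    [CommRing C] [IsDomain C] [Algebra k A] [Algebra k C] [Fintype ι] [Fintype κ]
    (f : ι → A →ₐ[k] C) (hf : ∀ i, Injective (f i))
    (hgen : Algebra.adjoin k (⋃ i, Set.range (f i)) = ⊤) {t : κ → A}
    (ht : IsTranscendenceBasis k t) :
    Algebra.trdeg k C ≤ (Fintype.card ι * Fintype.card κ : ℕ) := by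
  let s : Set C := Set.range fun p : ι × κ => f p.1 (t p.2)
  have hs : ∀ i a, IsAlgebraic (Algebra.adjoin k s) (f i a) := by
    intro i a
    have hmem : ∀ b : Algebra.adjoin k (Set.range t), f i b ∈ Algebra.adjoin k s := by
      rintro ⟨b, hb⟩
      have : f i b ∈ (Algebra.adjoin k (Set.range t)).map (f i) := ⟨b, hb, rfl⟩
      rw [AlgHom.map_adjoin, ← Set.range_comp] at this
      exact Algebra.adjoin_mono (by rintro _ ⟨j, rfl⟩; exact ⟨(i, j), rfl⟩) this
    exact (ht.isAlgebraic.isAlgebraic a).ringHom_of_comp_eq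
      (((f i).comp (Algebra.adjoin k (Set.range t)).val).codRestrict _ hmem).toRingHom
      (f i).toRingHom (fun b c hbc => Subtype.ext (hf i (congr_arg Subtype.val hbc))) rfl
  have halg : Algebra.IsAlgebraic (Algebra.adjoin k s) C := by
    refine ⟨fun c => ?_⟩
    have hc : c ∈ Algebra.adjoin k (⋃ i, Set.range (f i)) := hgen ▸ Algebra.mem_top
    have hle : Algebra.adjoin k (⋃ i, Set.range (f i)) ≤
        (Subalgebra.algebraicClosure (Algebra.adjoin k s) C).restrictScalars k := by
      rw [Algebra.adjoin_le_iff, Set.iUnion_subset_iff]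
      rintro i _ ⟨a, rfl⟩
      exact hs i a
    exact hle hc
  refine (Algebra.IsAlgebraic.trdeg_le_cardinalMk k s).trans ?_
  have hfin : s.Finite := Set.finite_range _
  have := hfin.fintype
  rw [Cardinal.mk_fintype]
  norm_cast
  classical
  exact (Fintype.card_le_of_surjective _ Set.rangeFactorization_surjective).trans
    (Fintype.card_prod ι κ).le

namespace SecantNondefectivity

variable {L : Type*} [AddCommGroup L] [Module ℂ L] {V : Set L}

/-- The inclusion of the coordinate ring of the `i`-th factor of `V ^ ι`. -/
def slotHom {ι : Type*} (V : Set L) (i : ι) : coordinateRing V →ₐ[ℂ] tupleRing ι V where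
  toFun f := ⟨fun x => (f : V → ℂ) (x i), slot_mem_tupleRing i f.2⟩
  map_one' := rfl
  map_mul' _ _ := rfl
  map_zero' := rfl
  map_add' _ _ := rfl
  commutes' _ := rfl

lemma slotHom_injective {ι : Type*} (i : ι) : Injective (slotHom V i) := fun _ _ hfg =>
  Subtype.ext (funext fun v => congr_fun (congr_arg Subtype.val hfg) fun _ => v)

lemma adjoin_iUnion_range_slotHom {ι : Type*} :
    Algebra.adjoin ℂ (⋃ i, Set.range (slotHom (ι := ι) V i)) = ⊤ := by
  apply Subalgebra.map_injective (f := (tupleRing ι V).val) Subtype.val_injective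
  rw [AlgHom.map_adjoin, Algebra.map_top, Subalgebra.range_val]
  apply le_antisymm
  · rw [Algebra.adjoin_le_iff]
    rintro _ ⟨f, -, rfl⟩
    exact f.2
  · refine Algebra.adjoin_mono ?_
    rintro _ ⟨⟨i, φ⟩, rfl⟩
    exact ⟨slotHom V i (linearCoord V φ), Set.mem_iUnion.2 ⟨i, _, rfl⟩, rfl⟩

lemma eval_mem_polynomialFunctions {σ : Type*} (φ : σ → Dual ℂ L) (P : MvPolynomial σ ℂ) :
    (fun y => MvPolynomial.eval (fun k => φ k y) P) ∈ polynomialFunctions L := by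
  induction P using MvPolynomial.induction_on with
  | C r =>
    simp only [MvPolynomial.eval_C]
    exact Subalgebra.algebraMap_mem (polynomialFunctions L) r
  | add p q hp hq =>
    simp only [map_add]
    exact add_mem hp hq
  | mul_X p k hp =>
    simp only [map_mul, MvPolynomial.eval_X]
    exact mul_mem hp (Algebra.subset_adjoin ⟨φ k, rfl⟩)

variable [FiniteDimensional ℂ L]

/-- If the sums of `r` points are dense, the coordinates of the sum are algebraically independent in
`tupleRing (Fin r) V`. That ring is generated by `r` copies of the coordinate ring, so its
transcendence degree is at most `r * varietyDim V`. -/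
theorem finrank_le_of_secantVariety_eq_univ (hV : IsIrreducibleAffineCone V) {r : ℕ}
    (hr : secantVariety r V = Set.univ) : finrank ℂ L ≤ r * varietyDim V := by
  have := hV.isDomain_tupleRing (Fin r)
  obtain ⟨t, ht⟩ := exists_isTranscendenceBasis_coordinateRing hV
  have hle := Algebra.trdeg_le_of_adjoin_iUnion_range (slotHom (ι := Fin r) V) slotHom_injective
    adjoin_iUnion_range_slotHom ht
  let b := finBasis ℂ L
  let s : Fin (finrank ℂ L) → tupleRing (Fin r) V := fun k =>
    ∑ i, slotHom V i (linearCoord V (b.coord k))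
  have hs : ∀ k x, (s k : (Fin r → V) → ℂ) x = b.coord k (∑ i, (x i : L)) := by
    intro k x
    simp only [s, AddSubmonoidClass.coe_finsetSum, Finset.sum_apply, map_sum]
    rfl
  have hind : AlgebraicIndependent ℂ s := by
    rw [algebraicIndependent_iff]
    intro P hP
    have hP' : ∀ x : Fin r → V,
        MvPolynomial.eval (fun k => b.coord k (∑ i, (x i : L))) P = 0 := by
      intro x
      have := congr_arg
        ((Pi.evalAlgHom ℂ (fun _ : Fin r → V => ℂ) x).comp (tupleRing (Fin r) V).val) hP
      rw [MvPolynomial.comp_aeval_apply, map_zero] at this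
      rw [← this, ← MvPolynomial.coe_aeval_eq_eval]
      simp only [← hs]
      rfl
    refine MvPolynomial.funext fun c => ?_
    have hy : b.equivFun.symm c ∈ secantVariety r V := hr ▸ Set.mem_univ _
    have := mem_zariski_closure_iff.1 hy _ (eval_mem_polynomialFunctions b.coord P) (by
      rintro _ ⟨x, hx, rfl⟩
      exact hP' fun i => ⟨x i, hx i⟩)
    have hc : ∀ k, b.coord k (b.equivFun.symm c) = c k := fun k => by
      rw [Basis.coord_apply, ← Basis.equivFun_apply, LinearEquiv.apply_symm_apply]
    simpa only [hc, map_zero] using this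
  have h := hind.lift_cardinalMk_le_trdeg.trans (Cardinal.lift_le.2 hle)
  rw [Cardinal.mk_fin, Cardinal.lift_natCast, Cardinal.lift_natCast, Fintype.card_fin,
    Fintype.card_fin] at h
  exact_mod_cast h

end SecantNondefectivity

end

/-! ### Equivariance and the strict decrease of the increments -/

section

open Filter Function Module

/-- A function of finite sets that is unchanged when an element is added to a set of size `m` is
constant on the sets of size `m`. -/
lemma Finset.apply_eq_of_apply_insert_eq {ι α : Type*} [DecidableEq ι] {f : Finset ι → α} {m : ℕ}
    (hf : ∀ S : Finset ι, S.card = m → ∀ i ∉ S, f (insert i S) = f S) {S S' : Finset ι}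
    (hS : S.card = m) (hS' : S'.card = m) : f S = f S' := by
  induction hn : (S' \ S).card generalizing S with
  | zero =>
    rw [Finset.card_eq_zero, Finset.sdiff_eq_empty_iff_subset] at hn
    rw [Finset.eq_of_subset_of_card_le hn (by omega)]
  | succ n ih =>
    obtain ⟨i, hi⟩ : (S' \ S).Nonempty := Finset.card_pos.1 (by omega)
    obtain ⟨j, hj⟩ : (S \ S').Nonempty := by
      rw [← Finset.card_pos, Finset.card_sdiff_comm (hS.trans hS'.symm)]
      omega
    rw [Finset.mem_sdiff] at hi hj
    have hij : j ≠ i := fun h => hi.2 (h ▸ hj.1)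
    -- `S` and the set obtained by swapping `j` for `i` both become `insert i S` on adding one
    -- element, so `f` agrees on them. The swap brings `S` closer to `S'`.
    have hcard : (insert i (S.erase j)).card = m := by
      rw [Finset.card_insert_of_notMem (by simp [hi.2]), Finset.card_erase_add_one hj.1, hS]
    have h1 : insert j (insert i (S.erase j)) = insert i S := by
      rw [Finset.insert_comm, Finset.insert_erase hj.1]
    rw [← hf S hS i hi.2, ← h1, hf _ hcard j (by simp [hij])]
    refine ih hcard ?_
    have : S' \ insert i (S.erase j) = (S' \ S).erase i := by
      ext k
      simp only [Finset.mem_sdiff, Finset.mem_insert, Finset.mem_erase]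
      by_cases hkj : k = j
      · subst hkj
        simp [hj.2]
      · tauto
    rw [this, Finset.card_erase_of_mem (by simp [hi]), hn]
    rfl

namespace SecantNondefectivity

variable {L : Type*} [AddCommGroup L] [Module ℂ L] {V : Set L}

section Equivariance

variable {G : Type*} [Group G] {ρ : Representation ℂ G L}

/-- The action of a group element on an invariant subset. -/
def translate (hGV : ∀ (g : G), ∀ v ∈ V, ρ g v ∈ V) (g : G) (v : V) : V := ⟨ρ g v, hGV g v v.2⟩

variable (hGV : ∀ (g : G), ∀ v ∈ V, ρ g v ∈ V)

@[simp] lemma coe_translate (g : G) (v : V) : (translate hGV g v : L) = ρ g v := rfl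

@[simp] lemma translate_translate_inv (g : G) (v : V) :
    translate hGV g (translate hGV g⁻¹ v) = v := Subtype.ext (by simp)

@[simp] lemma translate_inv_translate (g : G) (v : V) :
    translate hGV g⁻¹ (translate hGV g v) = v := Subtype.ext (by simp)

/-- The pullback of functions along the action of a group element. -/
def translateHom (g : G) : coordinateRing V →ₐ[ℂ] coordinateRing V where
  toFun f := ⟨fun v => (f : V → ℂ) (translate hGV g v), by
    obtain ⟨f, hf⟩ := f
    induction hf using Algebra.adjoin_induction with
    | mem f hf =>
      obtain ⟨φ, rfl⟩ := hf
      exact (linearCoord V (φ ∘ₗ ρ g)).2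
    | algebraMap r => exact Subalgebra.algebraMap_mem _ r
    | add p q _ _ hp hq => exact add_mem hp hq
    | mul p q _ _ hp hq => exact mul_mem hp hq⟩
  map_one' := rfl
  map_mul' _ _ := rfl
  map_zero' := rfl
  map_add' _ _ := rfl
  commutes' _ := rfl

lemma translateHom_apply (g : G) (f : coordinateRing V) (v : V) :
    (translateHom hGV g f : V → ℂ) v = (f : V → ℂ) (translate hGV g v) := rfl

lemma translateHom_linearCoord (g : G) (φ : Dual ℂ L) :
    translateHom hGV g (linearCoord V φ) = linearCoord V (φ ∘ₗ ρ g) := rfl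

lemma translateHom_inv_translateHom (g : G) (f : coordinateRing V) :
    translateHom hGV g⁻¹ (translateHom hGV g f) = f :=
  Subtype.ext (funext fun v => by simp [translateHom_apply])

/-- The conjugate of a derivation by the action of a group element. -/
def conjDerivation (g : G) (D : Derivation ℂ (coordinateRing V) (coordinateRing V)) :
    Derivation ℂ (coordinateRing V) (coordinateRing V) where
  toLinearMap := (translateHom hGV g⁻¹).toLinearMap ∘ₗ D.toLinearMap ∘ₗ
    (translateHom hGV g).toLinearMap
  map_one_eq_zero' := by simp
  leibniz' a b := by simp [translateHom_inv_translateHom]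

lemma conjDerivation_apply (g : G) (D : Derivation ℂ (coordinateRing V) (coordinateRing V))
    (f : coordinateRing V) :
    conjDerivation hGV g D f = translateHom hGV g⁻¹ (D (translateHom hGV g f)) := rfl

variable [FiniteDimensional ℂ L]

/-- The action is linear, so it is its own differential and carries the tangent vectors at `x` to
those at the translated point. -/
lemma tangentMap_translate (g : G) (x : V)
    (D : Derivation ℂ (coordinateRing V) (coordinateRing V)) :
    tangentMap (translate hGV g x) (conjDerivation hGV g D) = ρ g (tangentMap x D) := by
  rw [← sub_eq_zero, ← forall_dual_apply_eq_zero_iff ℂ]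
  intro φ
  rw [map_sub, sub_eq_zero, apply_tangentMap, conjDerivation_apply, translateHom_apply,
    translate_inv_translate, translateHom_linearCoord, ← apply_tangentMap]
  rfl

lemma map_mem_tangentSum_translate {ι : Type*} (g : G) {x : ι → V} {S : Finset ι} {u : L}
    (hu : u ∈ tangentSum x S) : ρ g u ∈ tangentSum (fun i => translate hGV g (x i)) S := by
  have : tangentSum x S ≤ (tangentSum (fun i => translate hGV g (x i)) S).comap (ρ g) := by
    rw [tangentSum_eq_span x, Submodule.span_le]
    rintro _ ⟨i, hi, D, rfl⟩
    rw [SetLike.mem_coe, Submodule.mem_comap, ← tangentMap_translate hGV]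
    exact tangentMap_mem_tangentSum (fun i => translate hGV g (x i)) hi _
  exact this hu

/-- The vectors that lie in the sum of the tangent spaces at `m` general points. -/
noncomputable def genericTangentVectors (hV : IsIrreducibleAffineCone V) (m : ℕ) :
    Submodule ℂ L where
  carrier := {u | ∀ᶠ x in genericFilter (Fin m) hV, u ∈ tangentSum x Finset.univ}
  zero_mem' := Filter.Eventually.of_forall (f := genericFilter (Fin m) hV)
    (p := fun x => (0 : L) ∈ tangentSum x Finset.univ) fun _ => zero_mem _
  add_mem' {u v} hu hv := by
    change ∀ᶠ x in genericFilter (Fin m) hV, u + v ∈ tangentSum x Finset.univ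
    filter_upwards [hu, hv] with x hx hy
    exact add_mem hx hy
  smul_mem' c u hu := by
    change ∀ᶠ x in genericFilter (Fin m) hV, c • u ∈ tangentSum x Finset.univ
    filter_upwards [hu] with x hx
    exact Submodule.smul_mem _ c hx

lemma mem_genericTangentVectors {hV : IsIrreducibleAffineCone V} {m : ℕ} {u : L} :
    u ∈ genericTangentVectors hV m ↔
      ∀ᶠ x in genericFilter (Fin m) hV, u ∈ tangentSum x Finset.univ := Iff.rfl

lemma map_mem_genericTangentVectors (hGV : ∀ (g : G), ∀ v ∈ V, ρ g v ∈ V)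
    {hV : IsIrreducibleAffineCone V} {m : ℕ} (g : G) {u : L}
    (hu : u ∈ genericTangentVectors hV m) : ρ g u ∈ genericTangentVectors hV m := by
  rw [mem_genericTangentVectors] at hu ⊢
  obtain ⟨p, hp, ⟨a, ha⟩, hpu⟩ := eventually_generic_iff.1 hu
  have := eventually_generic_comp (hV := hV) (f := fun x i => translate hGV g⁻¹ (x i))
    (fun i φ => linear_mem_tupleRing i (φ ∘ₗ ρ g⁻¹)) hp (z := fun i => translate hGV g (a i))
    (by simpa using ha) hpu
  filter_upwards [this] with x hx
  simpa using map_mem_tangentSum_translate hGV g hx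

/-- Translation by `g` preserves general position, so these vectors form a subrepresentation. This
is where irreducibility of the module enters. -/
lemma genericTangentVectors_eq_top (hρ : ρ.IsIrreducible) (hV : IsIrreducibleAffineCone V)
    (hGV : ∀ (g : G), ∀ v ∈ V, ρ g v ∈ V) {m : ℕ}
    {u : L} (hu : u ∈ genericTangentVectors hV m) (hu0 : u ≠ 0) :
    genericTangentVectors hV m = ⊤ := by
  let U : Subrepresentation ρ :=
    ⟨genericTangentVectors hV m, fun g _ hv => map_mem_genericTangentVectors hGV g hv⟩
  rcases hρ.eq_bot_or_eq_top U with h | h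
  · have : u ∈ (⊥ : Subrepresentation ρ) := h ▸ hu
    exact absurd this hu0
  · exact congr_arg Subrepresentation.toSubmodule h

end Equivariance

variable [FiniteDimensional ℂ L]

lemma tangentRank_eq_finrank_of_genericTangentVectors_eq_top {hV : IsIrreducibleAffineCone V}
    {m : ℕ} (h : genericTangentVectors hV m = ⊤) : tangentRank V m = finrank ℂ L := by
  let b := finBasis ℂ L
  have hb : ∀ᶠ x in genericFilter (Fin m) hV, ∀ i, b i ∈ tangentSum x Finset.univ :=
    eventually_all.2 fun i => mem_genericTangentVectors.1 (h ▸ Submodule.mem_top)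
  obtain ⟨x, hx⟩ := hb.exists
  have htop : tangentSum x Finset.univ = ⊤ := by
    rw [eq_top_iff, ← b.span_eq, Submodule.span_le]
    rintro _ ⟨i, rfl⟩
    exact hx i
  refine le_antisymm (tangentRank_le_finrank V m) ?_
  have := finrank_tangentSum_le x Finset.univ
  rwa [htop, finrank_top, Finset.card_fin] at this

/-- The dimension of the intersection of a general tangent space with the sum of the tangent
spaces at other general points. -/
lemma finrank_inf_tangentSum_add {ι : Type*} {x : ι → V}
    (hx : ∀ S : Finset ι, finrank ℂ (tangentSum x S) = tangentRank V S.card) {i : ι}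
    {S : Finset ι} (hi : i ∉ S) :
    finrank ℂ ↥(LinearMap.range (tangentMap (x i)) ⊓ tangentSum x S) + tangentRank V (S.card + 1) =
      tangentRank V 1 + tangentRank V S.card := by
  classical
  have := Submodule.finrank_sup_add_finrank_inf_eq (LinearMap.range (tangentMap (x i)))
    (tangentSum x S)
  rw [← tangentSum_insert, hx, Finset.card_insert_of_notMem hi, hx, ← tangentSum_singleton, hx,
    Finset.card_singleton] at this
  rw [← tangentSum_singleton]
  omega

lemma tangentRank_zero (V : Set L) : tangentRank V 0 = 0 := by
  refine Nat.le_zero.1 (csSup_le (Set.range_nonempty _) ?_)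
  rintro _ ⟨x, rfl⟩
  change Module.finrank ℂ (tangentSum x Finset.univ) ≤ 0
  rw [Finset.univ_eq_empty, tangentSum_eq_span]
  simp

lemma tangentRank_succ_le (hV : IsIrreducibleAffineCone V) (m : ℕ) :
    tangentRank V (m + 1) ≤ tangentRank V 1 + tangentRank V m := by
  obtain ⟨x, hx⟩ := (eventually_forall_finrank_tangentSum_eq (Fin (m + 1)) hV).exists
  have h := finrank_inf_tangentSum_add hx (Finset.notMem_erase 0 Finset.univ)
  rw [Finset.card_erase_of_mem (Finset.mem_univ _), Finset.card_fin, Nat.add_sub_cancel] at h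
  omega

lemma tangentRank_mono_succ (hV : IsIrreducibleAffineCone V) (m : ℕ) :
    tangentRank V m ≤ tangentRank V (m + 1) := by
  obtain ⟨x, hx⟩ := (eventually_forall_finrank_tangentSum_eq (Fin (m + 1)) hV).exists
  have h := Submodule.finrank_mono (tangentSum_mono x (Finset.univ.erase_subset 0))
  rwa [hx, hx, Finset.card_erase_of_mem (Finset.mem_univ _), Finset.card_fin,
    Nat.add_sub_cancel] at h

/-- If the increments of the dimensions of the general sums of tangent spaces stabilize at a value
below the dimension of `V`, then these sums are the whole space. -/
lemma tangentRank_eq_finrank {G : Type*} [Group G] {ρ : Representation ℂ G L}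
    (hρ : ρ.IsIrreducible) (hV : IsIrreducibleAffineCone V)
    (hGV : ∀ (g : G), ∀ v ∈ V, ρ g v ∈ V) {m : ℕ}
    (h : 2 * tangentRank V (m + 1) ≤ tangentRank V (m + 2) + tangentRank V m)
    (hlt : tangentRank V (m + 1) < tangentRank V 1 + tangentRank V m) :
    tangentRank V m = finrank ℂ L := by
  classical
  -- The index `none` carries the distinguished tangent space, and the two copies of `Fin m` carry
  -- two disjoint `m`-tuples to be compared.
  obtain ⟨p, hp, ⟨a, ha⟩, hpx⟩ := eventually_generic_iff.1
    (eventually_forall_finrank_tangentSum_eq (Option (Fin m ⊕ Fin m)) hV)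
  have key : ∀ x : Option (Fin m ⊕ Fin m) → V,
      (∀ S : Finset (Option (Fin m ⊕ Fin m)),
        finrank ℂ (tangentSum x S) = tangentRank V S.card) →
      LinearMap.range (tangentMap (x none)) ⊓ tangentSum (fun j => x (some (.inl j))) Finset.univ =
        LinearMap.range (tangentMap (x none)) ⊓
          tangentSum (fun j => x (some (.inr j))) Finset.univ := by
    intro x hx
    -- The dimension grows by `2 d (m + 1) - d (m + 2) - d m`, which is at most `0` by `h`. The two
    -- nested intersections therefore coincide.
    have hins : ∀ S : Finset (Fin m ⊕ Fin m), S.card = m → ∀ i ∉ S,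
        LinearMap.range (tangentMap (x none)) ⊓ tangentSum x ((insert i S).map .some) =
          LinearMap.range (tangentMap (x none)) ⊓ tangentSum x (S.map .some) := by
      intro S hS i hi
      have h1 := finrank_inf_tangentSum_add hx (i := none) (S := S.map .some) (by simp)
      have h2 := finrank_inf_tangentSum_add hx (i := none) (S := (insert i S).map .some) (by simp)
      rw [Finset.card_map, hS] at h1
      rw [Finset.card_map, Finset.card_insert_of_notMem hi, hS, add_assoc,
        one_add_one_eq_two] at h2
      refine (Submodule.eq_of_le_of_finrank_le (inf_le_inf_left _ (tangentSum_mono x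
        (Finset.map_subset_map.2 (Finset.subset_insert i S)))) ?_).symm
      omega
    have := Finset.apply_eq_of_apply_insert_eq
      (f := fun S => LinearMap.range (tangentMap (x none)) ⊓ tangentSum x (S.map .some)) hins
      (S := Finset.univ.map .inl)
      (S' := Finset.univ.map .inr) (by simp) (by simp)
    simp only [tangentSum_map] at this
    exact this
  -- The distinguished point and the first tuple stay fixed at `a` while the second tuple varies. A
  -- vector of the fixed intersection then lies in the tangent sum of a general second tuple.
  let f : (Fin m → V) → Option (Fin m ⊕ Fin m) → V := fun z o =>
    o.elim (a none) (Sum.elim (fun j => a (some (.inl j))) z)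
  have hfa : f (fun j => a (some (.inr j))) = a := by
    funext o
    rcases o with _ | j | j <;> rfl
  have hf : ∀ o (φ : Dual ℂ L), (fun z => φ (f z o)) ∈ tupleRing (Fin m) V := by
    rintro (_ | j | j) φ
    · exact Subalgebra.algebraMap_mem (tupleRing (Fin m) V) (φ (a none))
    · exact Subalgebra.algebraMap_mem (tupleRing (Fin m) V) (φ (a (some (.inl j))))
    · exact linear_mem_tupleRing j φ
  have hgen := eventually_generic_comp (hV := hV) hf hp (z := fun j => a (some (.inr j)))
    (by rwa [hfa]) hpx
  obtain ⟨u, hu, hu0⟩ : ∃ u ∈ LinearMap.range (tangentMap (a none)) ⊓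
      tangentSum (fun j => a (some (.inl j))) Finset.univ, u ≠ 0 := by
    -- The intersection is nonzero because `hlt` says that the increment falls short of the
    -- dimension of one tangent space.
    apply Submodule.exists_mem_ne_zero_of_ne_bot
    intro hbot
    have h1 := finrank_inf_tangentSum_add (hpx a ha) (i := none)
      (S := (Finset.univ.map .inl).map .some) (by simp)
    rw [tangentSum_map, tangentSum_map, Finset.card_map, Finset.card_map, Finset.card_fin] at h1
    have h2 : finrank ℂ ↥(LinearMap.range (tangentMap (a none)) ⊓
      tangentSum ((a ∘ Embedding.some) ∘ Embedding.inl) Finset.univ) = 0 := by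
      rw [show (a ∘ Embedding.some) ∘ Embedding.inl = fun j => a (some (.inl j)) from rfl, hbot,
        finrank_bot]
    omega
  refine tangentRank_eq_finrank_of_genericTangentVectors_eq_top (hV := hV)
    (genericTangentVectors_eq_top hρ hV hGV (u := u) ?_ hu0)
  rw [mem_genericTangentVectors]
  filter_upwards [hgen] with z hz
  exact ((key (f z) hz).le hu).2

end SecantNondefectivity

end

/-! ### Numerical conclusion and the main theorem -/

/-- A bounded monotone sequence whose increments start at `N` and, once they have dropped below `N`,
decrease strictly until the bound is attained. -/
lemma Nat.exists_eq_mul_and_eq_bound {d : ℕ → ℕ} {n N : ℕ} (hN : 0 < N) (d0 : d 0 = 0)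
    (hbound : ∀ m, d m ≤ n) (hmono : ∀ m, d m ≤ d (m + 1)) (hsucc : ∀ m, d (m + 1) ≤ N + d m)
    (hstrict : ∀ m, 2 * d (m + 1) ≤ d (m + 2) + d m → d (m + 1) < N + d m → d m = n) :
    ∃ k, (∀ m ≤ k, d m = m * N) ∧ d (k + N - 1) = n := by
  have hex : ∃ m, d (m + 1) < N + d m := by
    -- If every increment were at least `N ≥ 1`, then `d m ≥ m` would exceed the bound at `m = n +
    -- 1`.
    by_contra! hc
    have hd : ∀ m, m ≤ d m := by
      intro m
      induction m with
      | zero => omega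
      | succ m ih =>
        have := hc m
        omega
    have := hd (n + 1)
    have := hbound (n + 1)
    omega
  classical
  let k := Nat.find hex
  refine ⟨k, fun m => ?_, ?_⟩
  · induction m with
    | zero => simp [d0]
    | succ m ih =>
      intro hm
      have h1 := Nat.find_min hex (m := m) hm
      have h2 := hsucc m
      have h3 := ih (by omega)
      rw [Nat.add_one_mul]
      omega
  · have hincr : ∀ j, d (k + j) < n → d (k + j + 1) + (j + 1) ≤ N + d (k + j) := by
      intro j
      induction j with
      | zero =>
        intro _
        have : d (k + 1) < N + d k := Nat.find_spec hex
        simpa using this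
      | succ j ih =>
        intro hj
        have h0 := hmono (k + j)
        change d (k + j + 1) < n at hj
        change d (k + j + 2) + (j + 1 + 1) ≤ N + d (k + j + 1)
        have h1 := ih (by omega)
        by_contra hlt
        have h2 := hstrict (k + j) (by omega) (by omega)
        omega
    by_contra hne
    have hlt : d (k + (N - 1)) < n := by
      rw [← Nat.add_sub_assoc hN]
      exact lt_of_le_of_ne (hbound _) hne
    -- At `j = N - 1` the increment is at most `0`. By monotonicity the next one is not smaller, so
    -- `hstrict` forces the bound to be attained already.
    have h1 := hincr _ hlt
    have h2 := hmono (k + (N - 1))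
    have h3 : d (k + (N - 1) + 1) ≤ d (k + (N - 1) + 2) := hmono _
    have h4 := hstrict (k + (N - 1))
      (by omega) (by omega)
    omega

namespace SecantNondefectivity

variable {L : Type*} [AddCommGroup L] [Module ℂ L] {V : Set L}

lemma IsIrreducibleAffineCone.secantVariety_one (hV : IsIrreducibleAffineCone V) :
    secantVariety 1 V = V := by
  have : {y : L | ∃ x : Fin 1 → L, (∀ i, x i ∈ V) ∧ y = ∑ i, x i} = V := by
    ext y
    constructor
    · rintro ⟨x, hx, rfl⟩
      simpa using hx 0
    · exact fun hy => ⟨fun _ => y, fun _ => hy, by simp⟩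
  rw [secantVariety, this]
  exact @IsClosed.closure_eq L (zariskiTopology L) V hV.isClosed

/-- The upper bound is the half of Terracini's lemma for `m = 1`, where the secant variety is `V`
itself because `V` is closed. -/
lemma tangentRank_one [FiniteDimensional ℂ L] (hV : IsIrreducibleAffineCone V) :
    tangentRank V 1 = varietyDim V := by
  refine le_antisymm ?_ (varietyDim_le_tangentRank_one hV)
  simpa only [hV.secantVariety_one] using tangentRank_le_varietyDim hV 1

lemma tangentRank_le_mul [FiniteDimensional ℂ L] (hV : IsIrreducibleAffineCone V) (m : ℕ) :
    tangentRank V m ≤ m * varietyDim V := by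
  induction m with
  | zero => simp [tangentRank_zero]
  | succ m ih =>
    have := tangentRank_succ_le hV m
    rw [tangentRank_one hV] at this
    rw [Nat.add_one_mul]
    omega

end SecantNondefectivity

open SecantNondefectivity in
theorem mainTheorem1 {G L : Type*} [Group G] [AddCommGroup L] [Module ℂ L] [FiniteDimensional ℂ L]
    (ρ : Representation ℂ G L) (hρ : ρ.IsIrreducible)
    (V : Set L) (hV : SecantNondefectivity.IsIrreducibleAffineCone V)
    (hGV : ∀ (g : G), ∀ v ∈ V, ρ g v ∈ V)
    (N : ℕ) (hN : SecantNondefectivity.varietyDim V = N) (hN0 : 0 < N) :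
    (∀ m : ℕ, (m : ℝ) ≤ (Module.finrank ℂ L : ℝ) / (N : ℝ) - (N : ℝ) →
      SecantNondefectivity.IsNondefective m V) ∧
    ∃ r : ℕ, SecantNondefectivity.IsGenericRank V r ∧
      (Module.finrank ℂ L : ℝ) / (N : ℝ) ≤ (r : ℝ) ∧
      (r : ℝ) ≤ (Module.finrank ℂ L : ℝ) / (N : ℝ) + (N : ℝ) := by
  classical
  subst hN
  set N := varietyDim V with hN
  set n := Module.finrank ℂ L
  obtain ⟨k, hk, hkn⟩ := Nat.exists_eq_mul_and_eq_bound hN0 (tangentRank_zero V)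
    (tangentRank_le_finrank V) (tangentRank_mono_succ hV)
    (fun m => (tangentRank_succ_le hV m).trans_eq (by rw [tangentRank_one hV]))
    (fun m h hlt => tangentRank_eq_finrank hρ hV hGV h (by rwa [tangentRank_one hV]))
  have hnk : n ≤ (k + N - 1) * N := hkn.symm.trans_le (tangentRank_le_mul hV _)
  have hkN : k * N ≤ n := (hk k le_rfl).symm.trans_le (tangentRank_le_finrank V k)
  have hNR : (0 : ℝ) < N := by exact_mod_cast hN0
  refine ⟨fun m hm hdef => ?_, ?_⟩
  · have hmk : m ≤ k := by
      rw [le_sub_iff_add_le, le_div_iff₀ hNR] at hm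
      have h1 : (m + N) * N ≤ (k + N - 1) * N := le_trans (by exact_mod_cast hm) hnk
      have := Nat.le_of_mul_le_mul_right h1 hN0
      omega
    have h1 := tangentRank_le_varietyDim hV m
    rw [hk m hmk] at h1
    exact absurd (hdef.trans_le (min_le_left _ _)) (not_lt.2 h1)
  · have hex : ∃ m, secantVariety m V = Set.univ := ⟨_, secantVariety_eq_univ hV hkn⟩
    refine ⟨Nat.find hex, ⟨Nat.find_spec hex, fun m hm => Nat.find_min' hex hm⟩, ?_, ?_⟩
    · rw [div_le_iff₀ hNR]
      exact_mod_cast finrank_le_of_secantVariety_eq_univ hV (Nat.find_spec hex)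
    · have h1 : Nat.find hex ≤ k + N :=
        (Nat.find_min' hex (secantVariety_eq_univ hV hkn)).trans (Nat.sub_le _ _)
      have h2 : (k : ℝ) ≤ n / N := by
        rw [le_div_iff₀ hNR]
        exact_mod_cast hkN
      have h3 : (Nat.find hex : ℝ) ≤ k + N := by exact_mod_cast h1
      linarith
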